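/- Let $H(\mathbb{C})$ be the space of entire functions with the topology of uniform convergence on compact sets, and let $D$ be the differentiation operator $Df=f'$ on it. An entire function $\Phi(z)=\sum_{k\ge 0}a_kz^k$ is of exponential type if there are constants $A,B>0$ with $|\Phi(z)|\le Ae^{B|z|}$ for all $z\in\mathbb{C}$; in that case $(\Phi(D)f)(z)=\sum_{k\ge 0}a_kf^{(k)}(z)$ defines a continuous linear operator $\Phi(D)$ on $H(\mathbb{C})$. A sequence $(T_n)_{n\ge 1}$ of continuous linear operators on $H(\mathbb{C})$ is frequently hypercyclic if there is $f\in H(\mathbb{C})$ such that, for every nonempty open set $U\subset H(\mathbb{C})$, $$\liminf_{N\to\infty}\frac{\operatorname{card}\{1\le n\le N:\ T_nf\in U\}}{N}>0.$$ Let $(c_n)_{n\ge 1}$ be a sequence of nonzero complex numbers such that $$\gamma:=\liminf_{n\to\infty}\left|\frac{c_{n+1}}{c_n}\right|>0\quad\text{and}\quad \delta:=\limsup_{n\to\infty}\left|\frac{c_{n+1}}{c_n}\right|<+\infty .$$ Then the following hold. (i) Let $\Phi$ be an entire function of exponential type for which there exist $R_1,R_2\in(0,+\infty)$ such that $|\Phi(t)|<1/\delta$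 whenever $|t|=R_1$, $|\Phi(t)|>1/\gamma$ whenever $|t|=R_2$, and $\Phi(t)\ne 0$ for all $t\in\mathbb{C}$ with $\min\{R_1,R_2\}\le|t|\le\max\{R_1,R_2\}$. Then the sequence of operators $(c_n\Phi(D)^n)_{n\ge 1}$ is frequently hypercyclic on $H(\mathbb{C})$. (ii) The sequence of operators $(c_nD^n)_{n\ge 1}$ is frequently hypercyclic on $H(\mathbb{C})$. -/

import Mathlib

open Filter Topology

noncomputable section

/-- The entire functions, as a subspace of `C(ℂ, ℂ)`. The topology it inherits is
the compact-open topology, that is, uniform convergence on compact sets. -/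
def entireSubmodule : Submodule ℂ C(ℂ, ℂ) where
  carrier := {f | Differentiable ℂ (f : ℂ → ℂ)}
  add_mem' hf hg := Differentiable.add hf hg
  zero_mem' := differentiable_const (0 : ℂ)
  smul_mem' a _ hf := Differentiable.const_smul hf a

/-- The space `H(ℂ)` of entire functions. -/
abbrev EntireFunctions : Type := entireSubmodule

theorem EntireFunctions.differentiable (f : EntireFunctions) :
    Differentiable ℂ (f.1 : ℂ → ℂ) := f.2

theorem EntireFunctions.contDiff (f : EntireFunctions) (n : ℕ) :
    ContDiff ℂ n (f.1 : ℂ → ℂ) := f.differentiable.contDiff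

/-- The differentiation operator `D f = f'` on `H(ℂ)`. -/
def derivOp : EntireFunctions →L[ℂ] EntireFunctions where
  toFun f := ⟨⟨deriv f.1, ((f.contDiff 1).continuous_deriv le_rfl)⟩,
    (f.contDiff 2).differentiable_deriv_two⟩
  map_add' f g := by
    ext z
    exact deriv_add (f.differentiable z) (g.differentiable z)
  map_smul' a f := by
    ext z
    exact deriv_const_smul a (f.differentiable z)
  cont := by
    refine Continuous.subtype_mk ?_ _
    rw [continuous_iff_continuousAt]
    intro f
    have h : Tendsto (fun g : EntireFunctions => g.1) (𝓝 f) (𝓝 f.1) :=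
      continuous_subtype_val.tendsto f
    rw [ContinuousMap.tendsto_iff_tendstoLocallyUniformly,
      ← tendstoLocallyUniformlyOn_univ] at h
    rw [ContinuousAt, ContinuousMap.tendsto_iff_tendstoLocallyUniformly,
      ← tendstoLocallyUniformlyOn_univ]
    exact h.deriv (Eventually.of_forall fun g => g.differentiable.differentiableOn) isOpen_univ

/-- `Φ` is an entire function of exponential type. -/
def IsExponentialType (Φ : ℂ → ℂ) : Prop :=
  Differentiable ℂ Φ ∧
    ∃ A B : ℝ, 0 < A ∧ 0 < B ∧ ∀ z : ℂ, ‖Φ z‖ ≤ A * Real.exp (B * ‖z‖)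

/-- The `n`-th Taylor coefficient of `Φ` at the origin. -/
def taylorCoeff (Φ : ℂ → ℂ) (n : ℕ) : ℂ := iteratedDeriv n Φ 0 / (n.factorial : ℂ)

theorem IsExponentialType.norm_iteratedDeriv_le {Φ : ℂ → ℂ} (hΦ : IsExponentialType Φ) :
    ∃ A B : ℝ, 0 < A ∧ 0 < B ∧ ∀ n : ℕ, ‖iteratedDeriv n Φ 0‖ ≤ A * B ^ n := by
  obtain ⟨hd, A, B, hA, hB, h⟩ := hΦ
  refine ⟨A, Real.exp 1 * B, hA, by positivity, fun n => ?_⟩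
  rcases Nat.eq_zero_or_pos n with rfl | hn
  · simpa using h 0
  have hn' : (0 : ℝ) < n := by exact_mod_cast hn
  have hr : 0 < (n : ℝ) / B := by positivity
  have key := Complex.norm_iteratedDeriv_le_of_forall_mem_sphere_norm_le (c := 0)
    (C := A * Real.exp n) n hr hd.diffContOnCl (fun z hz => by
      have hz' : ‖z‖ = n / B := by simpa using hz
      have := h z
      rwa [hz', mul_div_cancel₀ _ hB.ne'] at this)
  refine key.trans ?_
  have hf : (n.factorial : ℝ) ≤ (n : ℝ) ^ n := by exact_mod_cast Nat.factorial_le_pow n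
  rw [div_pow, div_div_eq_mul_div, div_le_iff₀ (by positivity), mul_pow, ← Real.exp_nat_mul,
    mul_one]
  calc (n.factorial : ℝ) * (A * Real.exp n) * B ^ n
      ≤ (n : ℝ) ^ n * (A * Real.exp n) * B ^ n := by gcongr
    _ = A * (Real.exp n * B ^ n) * (n : ℝ) ^ n := by ring

theorem IsExponentialType.norm_term_le {Φ : ℂ → ℂ} (hΦ : IsExponentialType Φ) :
    ∃ C R : ℝ, 0 < C ∧ 0 < R ∧ ∀ (f : EntireFunctions) (z : ℂ) (M : ℝ),
      (∀ w ∈ Metric.sphere z R, ‖f.1 w‖ ≤ M) → ∀ n : ℕ,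
        ‖taylorCoeff Φ n * iteratedDeriv n f.1 z‖ ≤ C * M * (1 / 2) ^ n := by
  obtain ⟨A, B, hA, hB, h⟩ := hΦ.norm_iteratedDeriv_le
  refine ⟨A, 2 * B, hA, by positivity, fun f z M hM n => ?_⟩
  have key := Complex.norm_iteratedDeriv_le_of_forall_mem_sphere_norm_le n
    (by positivity : 0 < 2 * B) f.differentiable.diffContOnCl hM
  have hfac : (0 : ℝ) < n.factorial := by exact_mod_cast n.factorial_pos
  rw [norm_mul, taylorCoeff, norm_div, Complex.norm_natCast]
  calc ‖iteratedDeriv n Φ 0‖ / n.factorial * ‖iteratedDeriv n f.1 z‖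
      ≤ A * B ^ n / n.factorial * (n.factorial * M / (2 * B) ^ n) := by
        gcongr
        exact h n
    _ = A * M * (1 / 2) ^ n := by
        rw [mul_pow, div_pow, one_pow]
        field_simp

theorem IsExponentialType.summable {Φ : ℂ → ℂ} (hΦ : IsExponentialType Φ)
    (f : EntireFunctions) (z : ℂ) :
    Summable fun n : ℕ => taylorCoeff Φ n * iteratedDeriv n f.1 z := by
  obtain ⟨C, R, _, _, h⟩ := hΦ.norm_term_le
  obtain ⟨M, hM⟩ := (isCompact_sphere z R).exists_bound_of_continuousOn f.1.continuous.continuousOn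
  exact Summable.of_norm_bounded (summable_geometric_two.mul_left (C * M)) (h f z M hM)

theorem IsExponentialType.differentiable_tsum {Φ : ℂ → ℂ} (hΦ : IsExponentialType Φ)
    (f : EntireFunctions) :
    Differentiable ℂ fun z => ∑' n : ℕ, taylorCoeff Φ n * iteratedDeriv n f.1 z := by
  obtain ⟨C, R, _, _, h⟩ := hΦ.norm_term_le
  intro z₀
  obtain ⟨M, hM⟩ := (isCompact_closedBall z₀ (1 + R)).exists_bound_of_continuousOn
    f.1.continuous.continuousOn
  have := Complex.differentiableOn_tsum_of_summable_norm
    (F := fun n z => taylorCoeff Φ n * iteratedDeriv n f.1 z) (U := Metric.ball z₀ 1)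
    (summable_geometric_two.mul_left (C * M))
    (fun n => ((((f.contDiff (n + 1)).differentiable_iteratedDeriv n
      (by exact_mod_cast Nat.lt_succ_self n)).const_mul _).differentiableOn))
    Metric.isOpen_ball
    (fun n w hw => h f w M (fun v hv => hM v (by
      rw [Metric.mem_sphere] at hv
      rw [Metric.mem_ball] at hw
      rw [Metric.mem_closedBall]
      linarith [dist_triangle v w z₀])) n)
  exact this.differentiableAt (Metric.isOpen_ball.mem_nhds (Metric.mem_ball_self one_pos))

/-- The differential operator `Φ(D) = ∑ aₙ Dⁿ` on `H(ℂ)`, `(Φ(D) f)(z) = ∑ aₙ f⁽ⁿ⁾(z)`, where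
`Φ(z) = ∑ aₙ zⁿ` is an entire function of exponential type. -/
def diffOp (Φ : ℂ → ℂ) (hΦ : IsExponentialType Φ) : EntireFunctions →L[ℂ] EntireFunctions where
  toFun f := ⟨⟨fun z => ∑' n : ℕ, taylorCoeff Φ n * iteratedDeriv n f.1 z,
    (hΦ.differentiable_tsum f).continuous⟩, hΦ.differentiable_tsum f⟩
  map_add' f g := by
    ext z
    change ∑' n : ℕ, taylorCoeff Φ n * iteratedDeriv n (⇑f.1 + ⇑g.1) z =
      (∑' n : ℕ, taylorCoeff Φ n * iteratedDeriv n f.1 z) +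
        ∑' n : ℕ, taylorCoeff Φ n * iteratedDeriv n g.1 z
    rw [← (hΦ.summable f z).tsum_add (hΦ.summable g z)]
    refine tsum_congr fun n => ?_
    rw [iteratedDeriv_add (f.contDiff n).contDiffAt (g.contDiff n).contDiffAt, mul_add]
  map_smul' a f := by
    ext z
    change ∑' n : ℕ, taylorCoeff Φ n * iteratedDeriv n (a • ⇑f.1) z =
      a * ∑' n : ℕ, taylorCoeff Φ n * iteratedDeriv n f.1 z
    rw [← tsum_mul_left]
    refine tsum_congr fun n => ?_
    rw [iteratedDeriv_const_smul (f.contDiff n).contDiffAt, smul_eq_mul]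
    ring
  cont := by
    refine Continuous.subtype_mk ?_ _
    rw [continuous_iff_continuousAt]
    intro f
    obtain ⟨C, R, hC, hR, h⟩ := hΦ.norm_term_le
    have hT : Tendsto (fun g : EntireFunctions => g.1) (𝓝 f) (𝓝 f.1) :=
      continuous_subtype_val.tendsto f
    rw [ContinuousMap.tendsto_iff_forall_isCompact_tendstoUniformlyOn] at hT
    rw [ContinuousAt, ContinuousMap.tendsto_iff_forall_isCompact_tendstoUniformlyOn]
    intro K hK
    have h1 := hT (Metric.cthickening R K) hK.cthickening
    rw [Metric.tendstoUniformlyOn_iff] at h1 ⊢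
    intro ε hε
    filter_upwards [h1 (ε / (4 * C)) (by positivity)] with g hg z hz
    have hb := h (f - g) z (ε / (4 * C)) (fun w hw => by
      have hw' : w ∈ Metric.cthickening R K :=
        Metric.mem_cthickening_of_dist_le w z R K hz (le_of_eq hw)
      have := hg w hw'
      rw [dist_eq_norm] at this
      exact this.le)
    have hs : HasSum (fun n : ℕ => C * (ε / (4 * C)) * (1 / 2) ^ n) (C * (ε / (4 * C)) * 2) :=
      hasSum_geometric_two.mul_left _
    have hle := tsum_of_norm_bounded hs hb
    have heq : (∑' n : ℕ, taylorCoeff Φ n * iteratedDeriv n (f - g).1 z) =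
        (∑' n : ℕ, taylorCoeff Φ n * iteratedDeriv n f.1 z) -
          ∑' n : ℕ, taylorCoeff Φ n * iteratedDeriv n g.1 z := by
      rw [← (hΦ.summable f z).tsum_sub (hΦ.summable g z)]
      refine tsum_congr fun n => ?_
      rw [← mul_sub, ← iteratedDeriv_sub (f.contDiff n).contDiffAt (g.contDiff n).contDiffAt]
      rfl
    rw [heq] at hle
    change dist (∑' n : ℕ, taylorCoeff Φ n * iteratedDeriv n f.1 z)
      (∑' n : ℕ, taylorCoeff Φ n * iteratedDeriv n g.1 z) < ε
    rw [dist_eq_norm]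
    refine hle.trans_lt ?_
    have : C * (ε / (4 * C)) * 2 = ε / 2 := by field_simp; norm_num
    linarith

/-- The lower density `liminf card(A ∩ {1, …, n}) / n` of a set of positive integers. The quotients
lie in `[0, 1]`, so that the real `liminf` is the genuine one. -/
def lowerDensity (A : Set ℕ) : ℝ :=
  liminf (fun n : ℕ => ((A ∩ Set.Icc 1 n).ncard : ℝ) / n) atTop

/-- A sequence `(T₁, T₂, …)` of continuous linear maps is frequently hypercyclic if there is `x`
such that, for each nonempty open `U`, the set of `n ≥ 1` with `T n x ∈ U` has positive lower
density. The term `T 0` plays no role. -/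
def IsFrequentlyHypercyclic {X Y : Type*} [TopologicalSpace X] [AddCommMonoid X] [Module ℂ X]
    [TopologicalSpace Y] [AddCommMonoid Y] [Module ℂ Y] (T : ℕ → X →L[ℂ] Y) : Prop :=
  ∃ x : X, ∀ U : Set Y, IsOpen U → U.Nonempty → 0 < lowerDensity {n : ℕ | 1 ≤ n ∧ T n x ∈ U}

end

/-!
For `R > 0` and `G` continuous on the circle `|t| = R`, consider the entire function
`borelLaplace R G : z ↦ (2πi)⁻¹ ∮ exp (t z) G(t) dt`. Since `exp (t ·)` is an eigenvector of `Φ(D)`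
with eigenvalue `Φ t`, the operator `cₙ Φ(D)ⁿ` multiplies the density `G` by `Fₙ = cₙ Φⁿ`
(`diffOp_pow_borelLaplace`). Taylor polynomials are integrals of this kind with densities
holomorphic off the origin (`exists_borelLaplace_mem`), so that countably many such densities
`b₀, b₁, …` give targets inside a countable base of `H(ℂ)`.

For `δ'` slightly above `δ` and `γ'` slightly below `γ`, the quotient `cₖ / cₙ` is
`O(δ' ^ (k - n))` for `n ≤ k` and `O((1 / γ') ^ (n - k))` for `k ≤ n` (`exists_const_le_mul_pow`).
With the hypotheses on `Φ`, these estimates make `Fₖ / Fₙ` geometrically small in `|k - n|`: on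
`|t| = R₁` for `n < k`, and on `|t| = R₂` for `n > k`. Place targets `β j` at positions `n₀ < n₁ < …` and integrate
the density `∑ j, β j / F (n j)` over `|t| = R₂`. After `n k` steps its density is
`β k + ∑ j ≠ k, (F (n k) / F (n j)) β j`. The part `j > k` is small on `|t| = R₂`. The part `j < k`
is a finite sum of functions holomorphic in the closed annulus between the circles, since `Φ` does
not vanish there, so its integral may be taken over `|t| = R₁`, where it is small
(`exists_orbit_near_targets`).

The smallness has to beat the size of each target and the precision it requires. This is arranged
by positions carrying labels `v`, such that a position labelled `v` is farther than `v` from all the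
others while each label still occurs with positive lower density (`exists_separated_slots`); a
target is used only with labels large enough for it.

The statement on `D` is the case `Φ t = t`, where a small `R₁` and a large `R₂` satisfy the
hypotheses.
-/

/-! ### Lower density and separated slots -/

theorem lowerDensity_pos_of_linear_growth {A : Set ℕ} {g : ℕ → ℕ} (hg : Function.Injective g)
    (hA : ∀ i, g i ∈ A) (h1 : ∀ i, 1 ≤ g i) {K : ℕ} (hK : ∀ i, g i ≤ K * (i + 1)) :
    0 < lowerDensity A := by
  have hK0 : 0 < K := by
    have := (h1 0).trans (hK 0)
    omega
  have hfin : ∀ n : ℕ, (A ∩ Set.Icc 1 n).Finite := fun n =>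
    (Set.finite_Icc 1 n).subset Set.inter_subset_right
  have hcount : ∀ n : ℕ, n / K ≤ (A ∩ Set.Icc 1 n).ncard := by
    intro n
    have hsub : g '' (Finset.range (n / K) : Set ℕ) ⊆ A ∩ Set.Icc 1 n := by
      rintro _ ⟨i, hi, rfl⟩
      refine ⟨hA i, h1 i, (hK i).trans ?_⟩
      have hi' : i + 1 ≤ n / K := by simpa using hi
      exact (Nat.mul_le_mul_left K hi').trans (Nat.mul_div_le n K)
    have := Set.ncard_le_ncard hsub (hfin n)
    rwa [Set.ncard_image_of_injective _ hg, Set.ncard_coe_finset, Finset.card_range] at this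
  have hKr : (0 : ℝ) < K := by exact_mod_cast hK0
  refine lt_of_lt_of_le (by positivity : (0 : ℝ) < 1 / (2 * K)) ?_
  refine le_liminf_of_le ?_ ?_
  · refine IsBoundedUnder.isCoboundedUnder_ge ⟨1, ?_⟩
    rw [eventually_map]
    refine Eventually.of_forall fun n => div_le_one_of_le₀ ?_ n.cast_nonneg
    have := Set.ncard_le_ncard (Set.inter_subset_right : A ∩ Set.Icc 1 n ⊆ _) (Set.finite_Icc 1 n)
    simp only [Set.ncard_Icc_nat, Nat.add_sub_cancel] at this
    exact_mod_cast this
  · filter_upwards [eventually_ge_atTop (2 * K)] with n hn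
    have hn' : (2 * K : ℝ) ≤ n := by exact_mod_cast hn
    have hn0 : (0 : ℝ) < n := by linarith
    rw [div_le_div_iff₀ (by positivity) hn0, one_mul]
    have h2 : n < K * (n / K + 1) := by
      rw [mul_add, mul_one]
      exact Nat.lt_mul_div_succ n hK0
    have h3 : (n : ℝ) < K * ((n / K : ℕ) + 1) := by exact_mod_cast h2
    have h4 : ((n / K : ℕ) : ℝ) ≤ ((A ∩ Set.Icc 1 n).ncard : ℝ) := by exact_mod_cast hcount n
    nlinarith

/-- Positions `pos 0 < pos 1 < …` of linear growth and labels `val j` such that every label `v`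
occurs along positions of linear growth, and such that a position with label `v` is at a distance
more than `v` from all the others. With `val j` the `2`-adic valuation of `j + 1`, the gaps
`val j + val (j + 1) + 1` between neighbours add up to valuations of factorials, which grow
linearly. -/
theorem exists_separated_slots : ∃ pos val : ℕ → ℕ,
    (∀ j, val j + j + 1 ≤ pos j) ∧
    (∀ i j, i < j → pos i + val i + val j + (j - i) ≤ pos j) ∧
    ∀ v, ∃ g : ℕ → ℕ, Function.Injective g ∧ (∀ i, val (g i) = v) ∧
      ∃ K : ℕ, ∀ i, pos (g i) ≤ K * (i + 1) := by
  have : Fact (Nat.Prime 2) := ⟨Nat.prime_two⟩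
  have hfac : ∀ j : ℕ, padicValNat 2 (j + 1).factorial =
      padicValNat 2 (j + 1) + padicValNat 2 j.factorial := fun j => by
    rw [Nat.factorial_succ, padicValNat.mul (Nat.succ_ne_zero j) j.factorial_ne_zero]
  refine ⟨fun j => padicValNat 2 (j + 1).factorial + padicValNat 2 j.factorial + (j + 1),
    fun j => padicValNat 2 (j + 1), fun j => ?_, fun i j hij => ?_, fun v => ?_⟩
  · simp only [hfac]
    omega
  · induction j, hij using Nat.le_induction with
    | base =>
      simp only [Nat.succ_eq_add_one, hfac]
      omega
    | succ j hj ih =>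
      simp only [hfac] at ih ⊢
      omega
  · have hpos : ∀ i : ℕ, 0 < 2 ^ v * (2 * i + 1) := fun i => by positivity
    have hsub : ∀ i : ℕ, 2 ^ v * (2 * i + 1) - 1 + 1 = 2 ^ v * (2 * i + 1) := fun i =>
      Nat.sub_add_cancel (hpos i)
    refine ⟨fun i => 2 ^ v * (2 * i + 1) - 1, fun a b hab => ?_, fun i => ?_,
      6 * 2 ^ v, fun i => ?_⟩
    · have h : 2 ^ v * (2 * a + 1) = 2 ^ v * (2 * b + 1) := by
        rw [← hsub a, ← hsub b]
        exact congrArg (· + 1) hab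
      have := Nat.eq_of_mul_eq_mul_left (by positivity) h
      omega
    · change padicValNat 2 (2 ^ v * (2 * i + 1) - 1 + 1) = v
      rw [hsub, padicValNat.mul (by positivity) (by omega), padicValNat.prime_pow,
        padicValNat.eq_zero_of_not_dvd (by omega), add_zero]
    · have a1 := padicValNat_factorial_le (p := 2) (2 ^ v * (2 * i + 1) - 1 + 1)
      have a2 := padicValNat_factorial_le (p := 2) (2 ^ v * (2 * i + 1) - 1)
      have a3 := hsub i
      have a4 : 2 ^ v * (2 * i + 1) ≤ 2 ^ v * (2 * (i + 1)) := by gcongr; omega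
      calc _ ≤ 3 * (2 ^ v * (2 * (i + 1))) := by dsimp only; omega
        _ = 6 * 2 ^ v * (i + 1) := by ring

/-! ### Geometric control of ratios -/

/-- A positive sequence that eventually grows by a factor at most `ρ` in each step satisfies the
iterated estimate from every index on, up to a constant. -/
theorem exists_const_le_mul_pow {a : ℕ → ℝ} (ha : ∀ n, 1 ≤ n → 0 < a n) {ρ : ℝ} (hρ : 0 < ρ)
    (h : ∀ᶠ n in atTop, a (n + 1) ≤ ρ * a n) :
    ∃ C : ℝ, 0 < C ∧ ∀ n k, 1 ≤ n → n ≤ k → a k ≤ C * ρ ^ (k - n) * a n := by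
  obtain ⟨N, hN⟩ := eventually_atTop.1 h
  -- normalising by `ρ ^ n` reduces to an eventually antitone sequence
  set d : ℕ → ℝ := fun n => a n / ρ ^ n with hd
  have hdpos : ∀ n, 1 ≤ n → 0 < d n := fun n hn => div_pos (ha n hn) (by positivity)
  have hanti : ∀ n k, N ≤ n → n ≤ k → d k ≤ d n := by
    intro n k hn hnk
    induction k, hnk using Nat.le_induction with
    | base => exact le_rfl
    | succ k hk ih =>
      refine le_trans ?_ ih
      simp only [hd]
      rw [div_le_div_iff₀ (by positivity) (by positivity), pow_succ]
      nlinarith [hN k (hn.trans hk), pow_pos hρ k]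
  obtain ⟨M, hM⟩ := ((Finset.range (N + 1)).image d).bddAbove
  obtain ⟨M', hM'⟩ := ((Finset.range (N + 1)).image fun n => (d n)⁻¹).bddAbove
  have hMle : ∀ n, n ≤ N → d n ≤ M := fun n hn =>
    hM (Finset.mem_coe.2 (Finset.mem_image_of_mem d (Finset.mem_range.2 (Nat.lt_succ_of_le hn))))
  have hMle' : ∀ n, n ≤ N → (d n)⁻¹ ≤ M' := fun n hn =>
    hM' (Finset.mem_coe.2 (Finset.mem_image_of_mem (fun n => (d n)⁻¹)
      (Finset.mem_range.2 (Nat.lt_succ_of_le hn))))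
  have key : ∀ n k, 1 ≤ n → n ≤ k → d k ≤ (1 + |M| * |M'|) * d n := by
    intro n k hn hnk
    have hdn := hdpos n hn
    rcases le_total N n with hNn | hnN
    · refine (hanti n k hNn hnk).trans (le_mul_of_one_le_left hdn.le ?_)
      have : 0 ≤ |M| * |M'| := by positivity
      linarith
    · have h1 : d k ≤ |M| := by
        refine le_trans ?_ (le_abs_self M)
        rcases le_total k N with hk | hk
        · exact hMle k hk
        · exact (hanti N k le_rfl hk).trans (hMle N le_rfl)
      have h2 : 1 ≤ |M'| * d n := by
        rw [← inv_mul_cancel₀ hdn.ne']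
        exact mul_le_mul_of_nonneg_right ((hMle' n hnN).trans (le_abs_self _)) hdn.le
      calc d k ≤ |M| * 1 := by rwa [mul_one]
        _ ≤ |M| * (|M'| * d n) := by gcongr
        _ ≤ (1 + |M| * |M'|) * d n := by nlinarith
  refine ⟨1 + |M| * |M'|, by positivity, fun n k hn hnk => ?_⟩
  have h1 := key n k hn hnk
  simp only [hd] at h1
  rw [div_le_iff₀ (by positivity)] at h1
  refine h1.trans (le_of_eq ?_)
  rw [pow_sub₀ ρ hρ.ne' hnk]
  field_simp

/-! ### Borel–Laplace integrals over circles -/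

/-- The function `z ↦ (2πi)⁻¹ ∮ exp (t z) G(t) dt`, the integral being over `|t| = R`. -/
noncomputable def borelLaplace (R : ℝ) (G : ℂ → ℂ) (z : ℂ) : ℂ :=
  (2 * Real.pi * Complex.I : ℂ)⁻¹ • ∮ t in C(0, R), Complex.exp (t * z) * G t

section BorelLaplace

variable {R : ℝ} {G : ℂ → ℂ}

theorem norm_exp_mul_le {t : ℂ} (ht : ‖t‖ = R) (z : ℂ) :
    ‖Complex.exp (t * z)‖ ≤ Real.exp (R * ‖z‖) := by
  refine (Complex.norm_exp_le_exp_norm _).trans ?_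
  rw [norm_mul, ht]

theorem borelLaplace_congr (hR : 0 ≤ R) {H : ℂ → ℂ} (h : ∀ t, ‖t‖ = R → G t = H t) :
    borelLaplace R G = borelLaplace R H := by
  ext z
  unfold borelLaplace
  congr 1
  refine circleIntegral.integral_congr hR fun t ht => ?_
  rw [h t (by simpa using ht)]

theorem continuousOn_exp_mul (hG : ContinuousOn G (Metric.sphere 0 R)) (z : ℂ) :
    ContinuousOn (fun t => Complex.exp (t * z) * G t) (Metric.sphere 0 R) :=
  (Continuous.continuousOn (by fun_prop)).mul hG

theorem borelLaplace_add (hR : 0 ≤ R) {H : ℂ → ℂ} (hG : ContinuousOn G (Metric.sphere 0 R))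
    (hH : ContinuousOn H (Metric.sphere 0 R)) (z : ℂ) :
    borelLaplace R (fun t => G t + H t) z = borelLaplace R G z + borelLaplace R H z := by
  unfold borelLaplace
  rw [← smul_add, ← circleIntegral.integral_add
    ((continuousOn_exp_mul hG z).circleIntegrable hR)
    ((continuousOn_exp_mul hH z).circleIntegrable hR)]
  simp only [mul_add]

theorem norm_borelLaplace_le (hR : 0 ≤ R) {M : ℝ} (hM : ∀ t, ‖t‖ = R → ‖G t‖ ≤ M) (z : ℂ) :
    ‖borelLaplace R G z‖ ≤ R * M * Real.exp (R * ‖z‖) := by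
  rw [mul_assoc, mul_comm M]
  refine circleIntegral.norm_two_pi_i_inv_smul_integral_le_of_norm_le_const hR fun t ht => ?_
  have ht' : ‖t‖ = R := by simpa using ht
  rw [norm_mul]
  exact mul_le_mul (norm_exp_mul_le ht' z) (hM t ht') (norm_nonneg _) (Real.exp_nonneg _)

/-- Deformation of the circle of integration within an annulus where the density is
holomorphic. -/
theorem borelLaplace_eq_of_differentiableAt {r R : ℝ} (hr : 0 < r) (hR : 0 < R)
    (hG : ∀ t, min r R ≤ ‖t‖ → ‖t‖ ≤ max r R → DifferentiableAt ℂ G t) :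
    borelLaplace r G = borelLaplace R G := by
  wlog hle : r ≤ R generalizing r R
  · exact (this hR hr (by rwa [min_comm, max_comm]) (le_of_not_ge hle)).symm
  rw [min_eq_left hle, max_eq_right hle] at hG
  ext z
  unfold borelLaplace
  congr 1
  have hd : ∀ t, r ≤ ‖t‖ → ‖t‖ ≤ R →
      DifferentiableAt ℂ (fun t => Complex.exp (t * z) * G t) t := fun t h1 h2 =>
    (by fun_prop : DifferentiableAt ℂ (fun t => Complex.exp (t * z)) t).mul (hG t h1 h2)
  refine (Complex.circleIntegral_eq_of_differentiable_on_annulus_off_countable hr hle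
    Set.countable_empty (fun t ht => ?_) fun t ht => ?_).symm
  · simp only [Set.mem_sdiff, Metric.mem_closedBall, dist_zero_right, Metric.mem_ball, not_lt] at ht
    exact (hd t ht.2 ht.1).continuousAt.continuousWithinAt
  · simp only [Set.mem_sdiff, Metric.mem_closedBall, dist_zero_right, Metric.mem_ball, not_le] at ht
    exact hd t ht.1.2.le ht.1.1.le

theorem hasDerivAt_borelLaplace (hR : 0 ≤ R) (hG : ContinuousOn G (Metric.sphere 0 R)) (z : ℂ) :
    HasDerivAt (borelLaplace R G) (borelLaplace R (fun t => t * G t) z) z := by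
  obtain ⟨M, hM⟩ := (isCompact_sphere (0 : ℂ) R).exists_bound_of_continuousOn hG
  have hcm : ∀ θ, circleMap 0 R θ ∈ Metric.sphere (0 : ℂ) R := circleMap_mem_sphere _ hR
  have hcont : ∀ H : ℂ → ℂ, ContinuousOn H (Metric.sphere 0 R) → ∀ w : ℂ,
      Continuous fun θ : ℝ => deriv (circleMap 0 R) θ •
        (Complex.exp (circleMap 0 R θ * w) * H (circleMap 0 R θ)) := by
    intro H hH w
    have h1 : Continuous fun θ : ℝ => H (circleMap 0 R θ) :=
      hH.comp_continuous (continuous_circleMap _ _) hcm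
    have h2 : Continuous (circleMap (0 : ℂ) R) := continuous_circleMap _ _
    simp only [deriv_circleMap]
    exact (h2.mul continuous_const).smul ((by fun_prop : Continuous fun θ : ℝ =>
      Complex.exp (circleMap 0 R θ * w)).mul h1)
  have key := intervalIntegral.hasDerivAt_integral_of_dominated_loc_of_deriv_le
    (μ := MeasureTheory.volume) (a := 0) (b := 2 * Real.pi) (x₀ := z)
    (F := fun (w : ℂ) (θ : ℝ) => deriv (circleMap 0 R) θ •
      (Complex.exp (circleMap 0 R θ * w) * G (circleMap 0 R θ)))
    (F' := fun (w : ℂ) (θ : ℝ) => deriv (circleMap 0 R) θ •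
      (Complex.exp (circleMap 0 R θ * w) * (circleMap 0 R θ * G (circleMap 0 R θ))))
    (bound := fun _ => R * (Real.exp (R * (‖z‖ + 1)) * (R * M)))
    (Metric.ball_mem_nhds z one_pos)
    (Eventually.of_forall fun w => (hcont G hG w).aestronglyMeasurable)
    ((hcont G hG z).intervalIntegrable _ _)
    (hcont (fun t => t * G t) (continuousOn_id.mul hG) z).aestronglyMeasurable
    (Eventually.of_forall fun θ _ w hw => ?_)
    intervalIntegrable_const
    (Eventually.of_forall fun θ _ w _ => ?_)
  · exact key.2.fun_const_smul (2 * Real.pi * Complex.I : ℂ)⁻¹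
  · have h0 : ‖circleMap 0 R θ‖ = R := by simpa using hcm θ
    have hM0 : 0 ≤ M := (norm_nonneg _).trans (hM _ (hcm θ))
    rw [norm_smul, norm_mul, norm_mul, deriv_circleMap, norm_mul, Complex.norm_I, mul_one, h0]
    have hw' : ‖w‖ ≤ ‖z‖ + 1 := by
      have := norm_le_norm_add_norm_sub z w
      rw [Metric.mem_ball, dist_comm, dist_eq_norm] at hw
      linarith
    gcongr
    · exact (norm_exp_mul_le h0 w).trans (by gcongr)
    · exact hM _ (hcm θ)
  · have h := ((hasDerivAt_id' w).const_mul (circleMap 0 R θ)).cexp.mul_const (G (circleMap 0 R θ))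
    convert h.fun_const_smul (deriv (circleMap 0 R) θ) using 1
    simp only [mul_one, smul_eq_mul]
    ring

theorem differentiable_borelLaplace (hR : 0 ≤ R) (hG : ContinuousOn G (Metric.sphere 0 R)) :
    Differentiable ℂ (borelLaplace R G) := fun z =>
  (hasDerivAt_borelLaplace hR hG z).differentiableAt

theorem continuousOn_pow_mul (hG : ContinuousOn G (Metric.sphere 0 R)) (n : ℕ) :
    ContinuousOn (fun t => t ^ n * G t) (Metric.sphere 0 R) :=
  (continuous_pow n).continuousOn.mul hG

theorem iteratedDeriv_borelLaplace (hR : 0 ≤ R) (hG : ContinuousOn G (Metric.sphere 0 R)) (n : ℕ) :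
    iteratedDeriv n (borelLaplace R G) = borelLaplace R (fun t => t ^ n * G t) := by
  induction n with
  | zero => simp
  | succ n ih =>
    rw [iteratedDeriv_succ, ih]
    ext z
    rw [(hasDerivAt_borelLaplace hR (continuousOn_pow_mul hG n) z).deriv]
    congr 1
    ext t
    ring

/-- The integral of `t ^ (-(n + 1))` is a monomial, by Cauchy's formula. -/
theorem borelLaplace_pow_inv (hR : 0 < R) (n : ℕ) (z : ℂ) :
    borelLaplace R (fun t => 1 / t ^ (n + 1)) z = (n.factorial : ℂ)⁻¹ * z ^ n := by
  have hd : Differentiable ℂ fun t : ℂ => Complex.exp (t * z) := by fun_prop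
  have h := hd.diffContOnCl.circleIntegral_one_div_sub_center_pow_smul (c := 0) hR n
  have hi : iteratedDeriv n (fun t : ℂ => Complex.exp (t * z)) 0 = z ^ n := by
    have h2 : (fun t : ℂ => Complex.exp (t * z)) = fun t => Complex.exp (z * t) := by
      ext t
      rw [mul_comm]
    rw [h2, iteratedDeriv_cexp_const_mul]
    simp
  rw [hi] at h
  unfold borelLaplace
  simp only [sub_zero, smul_eq_mul] at h ⊢
  simp only [mul_comm (Complex.exp _), h]
  have : (2 * Real.pi * Complex.I : ℂ) ≠ 0 := Complex.two_pi_I_ne_zero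
  field_simp

theorem borelLaplace_const_mul (a : ℂ) (z : ℂ) :
    borelLaplace R (fun t => a * G t) z = a * borelLaplace R G z := by
  unfold borelLaplace
  simp only [mul_left_comm _ a, circleIntegral.integral_const_mul, smul_eq_mul]

theorem borelLaplace_sum (hR : 0 ≤ R) {ι : Type*} (s : Finset ι) {H : ι → ℂ → ℂ}
    (hH : ∀ i ∈ s, ContinuousOn (H i) (Metric.sphere 0 R)) (z : ℂ) :
    borelLaplace R (fun t => ∑ i ∈ s, H i t) z = ∑ i ∈ s, borelLaplace R (H i) z := by
  classical
  induction s using Finset.induction_on with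
  | empty => simp [borelLaplace, circleIntegral]
  | insert i s hi ih =>
    simp only [Finset.sum_insert hi]
    rw [borelLaplace_add hR (hH i (by simp)) (continuousOn_finsetSum _ fun j hj =>
      hH j (by simp [hj])), ih fun j hj => hH j (by simp [hj])]

/-- Integration of a series over the circle, term by term. -/
theorem hasSum_borelLaplace (hR : 0 ≤ R) {H : ℕ → ℂ → ℂ} {S : ℂ → ℂ} {u : ℕ → ℝ}
    (hH : ∀ n, ContinuousOn (H n) (Metric.sphere 0 R)) (hu : Summable u)
    (hb : ∀ n t, ‖t‖ = R → ‖H n t‖ ≤ u n) (hS : ∀ t, ‖t‖ = R → HasSum (fun n => H n t) (S t))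
    (z : ℂ) :
    HasSum (fun n => borelLaplace R (H n) z) (borelLaplace R S z) := by
  have hS' : ContinuousOn S (Metric.sphere 0 R) := by
    refine (continuousOn_tsum hH hu fun n t ht => hb n t (by simpa using ht)).congr fun t ht => ?_
    exact (hS t (by simpa using ht)).tsum_eq.symm
  rw [hasSum_iff_tendsto_nat_of_summable_norm]
  · have hsum : ∀ n, ∑ i ∈ Finset.range n, borelLaplace R (H i) z - borelLaplace R S z
        = borelLaplace R (fun t => ∑ i ∈ Finset.range n, H i t + (-1) * S t) z := by
      intro n
      rw [borelLaplace_add hR (continuousOn_finsetSum _ fun i _ => hH i)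
        (continuousOn_const.fun_mul hS'), borelLaplace_sum hR _ fun i _ => hH i,
        borelLaplace_const_mul]
      ring
    have htail := (tendsto_sum_nat_add u)
    rw [tendsto_iff_norm_sub_tendsto_zero]
    refine squeeze_zero (fun _ => norm_nonneg _) (g := fun n =>
      R * (∑' k, u (k + n)) * Real.exp (R * ‖z‖)) (fun n => ?_) ?_
    · rw [hsum]
      refine norm_borelLaplace_le hR (fun t ht => ?_) z
      have h1 := (hasSum_nat_add_iff' n).2 (hS t ht)
      have h2 := h1.tsum_eq ▸ tsum_of_norm_bounded ((summable_nat_add_iff n).2 hu).hasSum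
        (fun k => hb (k + n) t ht)
      rwa [neg_one_mul, ← sub_eq_add_neg, norm_sub_rev]
    · simpa using (htail.const_mul R).mul_const (Real.exp (R * ‖z‖))
  · exact Summable.of_nonneg_of_le (fun _ => norm_nonneg _)
      (fun n => norm_borelLaplace_le hR (hb n) z) ((hu.mul_left R).mul_right _)

/-! ### The action of `Φ(D)` -/

theorem hasSum_taylorCoeff {Φ : ℂ → ℂ} (hΦ : Differentiable ℂ Φ) (t : ℂ) :
    HasSum (fun n => taylorCoeff Φ n * t ^ n) (Φ t) := by
  have h := Complex.hasSum_taylorSeries_of_entire hΦ 0 t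
  have e : (fun n => taylorCoeff Φ n * t ^ n) =
      fun n : ℕ => (n.factorial : ℂ)⁻¹ • (t - 0) ^ n • iteratedDeriv n Φ 0 := by
    funext n
    simp only [taylorCoeff, sub_zero, smul_eq_mul]
    ring
  rwa [e]

/-- On Borel–Laplace integrals `Φ(D)` acts as multiplication of the density by `Φ`, because
`exp (t ·)` is an eigenvector of `Φ(D)` with eigenvalue `Φ t`. -/
theorem diffOp_borelLaplace {Φ : ℂ → ℂ} (hΦ : IsExponentialType Φ) (hR : 0 < R)
    (hG : ContinuousOn G (Metric.sphere 0 R)) {f : EntireFunctions}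
    (hf : ∀ z, f.1 z = borelLaplace R G z) (z : ℂ) :
    (diffOp Φ hΦ f).1 z = borelLaplace R (fun t => Φ t * G t) z := by
  obtain ⟨M, hM⟩ := (isCompact_sphere (0 : ℂ) R).exists_bound_of_continuousOn hG
  have hf' : (f.1 : ℂ → ℂ) = borelLaplace R G := funext hf
  change ∑' n : ℕ, taylorCoeff Φ n * iteratedDeriv n f.1 z = _
  have hs : Summable fun n => ‖taylorCoeff Φ n * (R : ℂ) ^ n‖ :=
    (hasSum_taylorCoeff hΦ.1 (R : ℂ)).summable.norm
  have h := hasSum_borelLaplace hR.le (H := fun n t => taylorCoeff Φ n * (t ^ n * G t))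
    (S := fun t => Φ t * G t) (u := fun n => ‖taylorCoeff Φ n * (R : ℂ) ^ n‖ * M)
    (fun n => continuousOn_const.mul (continuousOn_pow_mul hG n)) (hs.mul_right M)
    (fun n t ht => ?_) (fun t _ => ?_) z
  · rw [← h.tsum_eq]
    refine tsum_congr fun n => ?_
    rw [hf', iteratedDeriv_borelLaplace hR.le hG, borelLaplace_const_mul]
  · rw [← mul_assoc, norm_mul]
    refine mul_le_mul (le_of_eq ?_) (hM t (by simpa using ht)) (norm_nonneg _) (norm_nonneg _)
    rw [norm_mul, norm_mul, norm_pow, norm_pow, ht, Complex.norm_real, Real.norm_of_nonneg hR.le]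
  · simpa only [mul_assoc] using (hasSum_taylorCoeff hΦ.1 t).mul_right (G t)

theorem diffOp_pow_borelLaplace {Φ : ℂ → ℂ} (hΦ : IsExponentialType Φ) (hR : 0 < R)
    (hG : ContinuousOn G (Metric.sphere 0 R)) {f : EntireFunctions}
    (hf : ∀ z, f.1 z = borelLaplace R G z) (n : ℕ) (z : ℂ) :
    ((diffOp Φ hΦ ^ n) f).1 z = borelLaplace R (fun t => Φ t ^ n * G t) z := by
  induction n generalizing z with
  | zero => simp [hf]
  | succ n ih =>
    rw [pow_succ', mul_apply_eq_comp, diffOp_borelLaplace hΦ hR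
      ((hΦ.1.continuous.continuousOn.fun_pow n).fun_mul hG) ih]
    congr 1
    ext t
    ring

end BorelLaplace

theorem isExponentialType_id : IsExponentialType (fun z => z) := by
  refine ⟨differentiable_fun_id, 1, 1, one_pos, one_pos, fun z => ?_⟩
  rw [one_mul, one_mul]
  linarith [Real.add_one_le_exp ‖z‖]

theorem diffOp_id : diffOp (fun z => z) isExponentialType_id = derivOp := by
  have h0 : ∀ n, n ≠ 1 → taylorCoeff (fun z => z) n = 0 := by
    intro n hn
    rcases n with _ | _ | n
    · simp [taylorCoeff]
    · simp at hn
    · have : deriv (fun z : ℂ => z) = fun _ => 1 := by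
        ext z
        simp
      simp [taylorCoeff, iteratedDeriv_succ', this]
  ext f z
  change ∑' n : ℕ, taylorCoeff (fun z => z) n * iteratedDeriv n f.1 z = deriv f.1 z
  rw [tsum_eq_single 1 fun n hn => by rw [h0 n hn, zero_mul]]
  simp [taylorCoeff]

/-! ### Approximation in the space of entire functions -/

theorem tendsto_entireFunctions {ι : Type*} {l : Filter ι} {g : ι → EntireFunctions}
    {p : EntireFunctions} (h : ∀ K : Set ℂ, IsCompact K →
      TendstoUniformlyOn (fun i z => (g i).1 z) (fun z => p.1 z) l K) : Tendsto g l (𝓝 p) := by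
  rw [tendsto_subtype_rng, ContinuousMap.tendsto_iff_forall_isCompact_tendstoUniformlyOn]
  exact h

/-- Closeness in a weighted norm of exponential type is finer than uniform closeness on compact
sets. -/
theorem exists_exponential_neighborhood {U : Set EntireFunctions} (hU : IsOpen U)
    {p : EntireFunctions} (hp : p ∈ U) {R : ℝ} (hR : 0 ≤ R) :
    ∃ η : ℝ, 0 < η ∧ ∀ g : EntireFunctions,
      (∀ z, ‖g.1 z - p.1 z‖ ≤ η * Real.exp (R * ‖z‖)) → g ∈ U := by
  by_contra! hcon
  choose g hg hgU using fun n : ℕ => hcon (1 / ((n : ℝ) + 1)) Nat.one_div_pos_of_nat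
  have hlim : Tendsto g atTop (𝓝 p) := by
    refine tendsto_entireFunctions fun K hK => ?_
    obtain ⟨r, hr⟩ := hK.isBounded.exists_norm_le
    rw [Metric.tendstoUniformlyOn_iff]
    intro ε hε
    have h0 : Tendsto (fun n : ℕ => 1 / ((n : ℝ) + 1) * Real.exp (R * r)) atTop (𝓝 0) := by
      simpa using tendsto_one_div_add_atTop_nhds_zero_nat.mul_const (Real.exp (R * r))
    filter_upwards [h0.eventually (gt_mem_nhds hε)] with n hn z hz
    rw [dist_comm, dist_eq_norm]
    refine ((hg n z).trans ?_).trans_lt hn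
    gcongr
    exact hr z hz
  obtain ⟨n, hn⟩ := (hlim.eventually (hU.mem_nhds hp)).exists
  exact hgU n hn

/-- Taylor polynomials are Borel–Laplace integrals of polynomials in `1 / t`, so that such
integrals are dense in the space of entire functions. -/
theorem exists_borelLaplace_mem {U : Set EntireFunctions} (hU : IsOpen U) (hne : U.Nonempty)
    {R : ℝ} (hR : 0 < R) :
    ∃ b : ℂ → ℂ, (∀ t, t ≠ 0 → DifferentiableAt ℂ b t) ∧
      ∃ p ∈ U, ∀ z, p.1 z = borelLaplace R b z := by
  obtain ⟨f, hf⟩ := hne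
  set b : ℕ → ℂ → ℂ := fun N t => ∑ n ∈ Finset.range N, iteratedDeriv n f.1 0 * (1 / t ^ (n + 1))
    with hb
  have hbd : ∀ N t, t ≠ 0 → DifferentiableAt ℂ (b N) t := by
    intro N t ht
    refine DifferentiableAt.fun_sum fun n _ => ?_
    exact (differentiableAt_const _).mul
      ((differentiableAt_const _).div (differentiableAt_id.pow _) (pow_ne_zero _ ht))
  have hne0 : ∀ t ∈ Metric.sphere (0 : ℂ) R, t ≠ 0 := fun t ht => Metric.ne_of_mem_sphere ht hR.ne'
  have hbc : ∀ N, ContinuousOn (b N) (Metric.sphere 0 R) := fun N t ht =>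
    (hbd N t (hne0 t ht)).continuousAt.continuousWithinAt
  set p : ℕ → EntireFunctions := fun N => ⟨⟨borelLaplace R (b N),
    (differentiable_borelLaplace hR.le (hbc N)).continuous⟩,
    differentiable_borelLaplace hR.le (hbc N)⟩ with hp
  have hpe : ∀ N z, (p N).1 z =
      ∑ n ∈ Finset.range N, iteratedDeriv n f.1 0 * ((n.factorial : ℂ)⁻¹ * z ^ n) := by
    intro N z
    change borelLaplace R (b N) z = _
    simp only [hb]
    rw [borelLaplace_sum hR.le]
    · simp only [borelLaplace_const_mul, borelLaplace_pow_inv hR]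
    · intro n _
      exact continuousOn_const.mul (continuousOn_const.div (continuousOn_id.pow _)
        fun t ht => pow_ne_zero _ (hne0 t ht))
  have hsum : ∀ z, HasSum (fun n => iteratedDeriv n f.1 0 * ((n.factorial : ℂ)⁻¹ * z ^ n))
      (f.1 z) := by
    intro z
    have e : (fun n => iteratedDeriv n f.1 0 * ((n.factorial : ℂ)⁻¹ * z ^ n)) =
        fun n : ℕ => (n.factorial : ℂ)⁻¹ • (z - 0) ^ n • iteratedDeriv n f.1 0 := by
      funext n
      simp only [sub_zero, smul_eq_mul]
      ring
    rw [e]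
    exact Complex.hasSum_taylorSeries_of_entire f.differentiable 0 z
  have hlim : Tendsto p atTop (𝓝 f) := by
    refine tendsto_entireFunctions fun K hK => ?_
    obtain ⟨r, hr⟩ := hK.isBounded.exists_norm_le
    have hu := (hsum (r : ℂ)).summable.norm
    have := tendstoUniformlyOn_tsum_nat hu (s := K)
      (f := fun n z => iteratedDeriv n f.1 0 * ((n.factorial : ℂ)⁻¹ * z ^ n)) fun n z hz => by
        have h1 : ‖z‖ ≤ ‖(r : ℂ)‖ := by
          rw [Complex.norm_real]
          exact (hr z hz).trans (le_abs_self r)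
        simp only [norm_mul, norm_pow]
        gcongr
    refine (this.congr_right fun z _ => (hsum z).tsum_eq).congr ?_
    exact Eventually.of_forall fun N z _ => (hpe N z).symm
  obtain ⟨N, hN⟩ := (hlim.eventually (hU.mem_nhds hf)).exists
  exact ⟨b N, hbd N, p N, hN, fun z => rfl⟩

/-! ### Orbits visiting prescribed targets -/

theorem pow_mul_le_pow {q x : ℝ} (hq0 : 0 ≤ q) (hq1 : q ≤ 1) (hx0 : 0 ≤ x) {a d m : ℕ}
    (hm : a + d ≤ m) (hx : x * q ^ a ≤ 1) : q ^ m * x ≤ q ^ d := by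
  calc q ^ m * x ≤ q ^ (a + d) * x :=
        mul_le_mul_of_nonneg_right (pow_le_pow_of_le_one hq0 hq1 hm) hx0
    _ = q ^ d * (x * q ^ a) := by ring
    _ ≤ q ^ d := mul_le_of_le_one_right (pow_nonneg hq0 d) hx

/-- Let `T n` multiply the densities of Borel–Laplace integrals by `F n`, with `F k / F n`
geometrically small on `|t| = R₁` for `n < k`, and on `|t| = R₂` for `k < n`. At the positions
`pos k`, the orbit of the integral with density `∑ j, β (val j) / F (pos j)` is close to the
integral of `β (val k)`: the contribution of the slots `j > k` is small on `|t| = R₂`, and that of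
the finitely many slots `j < k` may be integrated over `|t| = R₁`, where it is small. -/
theorem exists_orbit_near_targets {T : ℕ → EntireFunctions →L[ℂ] EntireFunctions}
    {F : ℕ → ℂ → ℂ} {R₁ R₂ : ℝ} (hR₁ : 0 < R₁) (hR₂ : 0 < R₂)
    (hF : ∀ n, Differentiable ℂ (F n))
    (hF0 : ∀ n, 1 ≤ n → ∀ t, min R₁ R₂ ≤ ‖t‖ → ‖t‖ ≤ max R₁ R₂ → F n t ≠ 0)
    (hT : ∀ (n : ℕ) (G : ℂ → ℂ) (f : EntireFunctions), ContinuousOn G (Metric.sphere 0 R₂) →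
      (∀ z, f.1 z = borelLaplace R₂ G z) →
      ∀ z, (T n f).1 z = borelLaplace R₂ (fun t => F n t * G t) z)
    {C q : ℝ} (hC : 0 < C) (hq0 : 0 < q) (hq1 : q < 1)
    (h1 : ∀ n k, 1 ≤ n → n ≤ k → ∀ t, ‖t‖ = R₁ → ‖F k t / F n t‖ ≤ C * q ^ (k - n))
    (h2 : ∀ k n, 1 ≤ k → k ≤ n → ∀ t, ‖t‖ = R₂ → ‖F k t / F n t‖ ≤ C * q ^ (n - k))
    {pos val : ℕ → ℕ} (hpos : ∀ j, val j + j + 1 ≤ pos j)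
    (hsep : ∀ i j, i < j → pos i + val i + val j + (j - i) ≤ pos j)
    {β : ℕ → ℂ → ℂ} (hβ : ∀ v t, t ≠ 0 → DifferentiableAt ℂ (β v) t)
    (hβ1 : ∀ v t, ‖t‖ = R₁ → ‖β v t‖ * q ^ v ≤ 1)
    (hβ2 : ∀ v t, ‖t‖ = R₂ → ‖β v t‖ * q ^ v ≤ 1) :
    ∃ f : EntireFunctions, ∀ k z,
      ‖(T (pos k) f).1 z - borelLaplace R₂ (β (val k)) z‖ ≤
        (R₁ + R₂) * (C * (1 - q)⁻¹) * q ^ val k * Real.exp (max R₁ R₂ * ‖z‖) := by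
  have hann2 : ∀ t : ℂ, ‖t‖ = R₂ → min R₁ R₂ ≤ ‖t‖ ∧ ‖t‖ ≤ max R₁ R₂ := fun t ht =>
    ⟨ht ▸ min_le_right _ _, ht ▸ le_max_right _ _⟩
  have hmem : ∀ t : ℂ, t ∈ Metric.sphere (0 : ℂ) R₂ → ‖t‖ = R₂ := fun t ht => by simpa using ht
  have hne : ∀ t : ℂ, min R₁ R₂ ≤ ‖t‖ → t ≠ 0 := fun t ht =>
    norm_pos_iff.1 ((lt_min hR₁ hR₂).trans_le ht)
  have hpos1 : ∀ j, 1 ≤ pos j := fun j => le_trans (by omega) (hpos j)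
  have hβc : ∀ v, ContinuousOn (β v) (Metric.sphere 0 R₂) := fun v t ht =>
    (hβ v t (hne t (hann2 t (hmem t ht)).1)).continuousAt.continuousWithinAt
  have hFc : ∀ n, ContinuousOn (F n) (Metric.sphere 0 R₂) := fun n => (hF n).continuous.continuousOn
  have hF2 : ∀ n, 1 ≤ n → ∀ t ∈ Metric.sphere (0 : ℂ) R₂, F n t ≠ 0 := fun n hn t ht =>
    hF0 n hn t (hann2 t (hmem t ht)).1 (hann2 t (hmem t ht)).2
  -- the density of the vector
  set w : ℕ → ℂ → ℂ := fun j t => β (val j) t / F (pos j) t with hw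
  have hwc : ∀ j, ContinuousOn (w j) (Metric.sphere 0 R₂) := fun j =>
    (hβc _).div (hFc _) (hF2 _ (hpos1 j))
  obtain ⟨μ, hμ⟩ := (isCompact_sphere (0 : ℂ) R₂).exists_bound_of_continuousOn
    ((hFc 1).inv₀ (hF2 1 le_rfl))
  have hwb : ∀ j, ∀ t ∈ Metric.sphere (0 : ℂ) R₂, ‖w j t‖ ≤ C * μ * q ^ j := by
    intro j t ht
    have e : w j t = (F 1 t / F (pos j) t * β (val j) t) * (F 1 t)⁻¹ := by
      simp only [hw]
      have := hF2 1 le_rfl t ht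
      field_simp
    have hμ0 : 0 ≤ μ := (norm_nonneg _).trans (hμ t ht)
    have hq := pow_mul_le_pow hq0.le hq1.le (norm_nonneg (β (val j) t)) (a := val j) (d := j)
      (m := pos j - 1) (by have := hpos j; omega) (hβ2 (val j) t (hmem t ht))
    rw [e, norm_mul, norm_mul]
    calc _ ≤ C * q ^ (pos j - 1) * ‖β (val j) t‖ * μ := by
          gcongr
          · exact h2 1 (pos j) le_rfl (hpos1 j) t (hmem t ht)
          · exact hμ t ht
      _ = C * μ * (q ^ (pos j - 1) * ‖β (val j) t‖) := by ring
      _ ≤ C * μ * q ^ j := by gcongr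
  have hgeo : Summable fun j : ℕ => q ^ j := summable_geometric_of_lt_one hq0.le hq1
  set G : ℂ → ℂ := fun t => ∑' j, w j t with hG
  have hGc : ContinuousOn G (Metric.sphere 0 R₂) :=
    continuousOn_tsum hwc (hgeo.mul_left (C * μ)) hwb
  refine ⟨⟨⟨borelLaplace R₂ G, (differentiable_borelLaplace hR₂.le hGc).continuous⟩,
    differentiable_borelLaplace hR₂.le hGc⟩, fun k z => ?_⟩
  rw [hT (pos k) G _ hGc (fun z => rfl) z]
  set u : ℕ → ℂ → ℂ := fun j t => F (pos k) t / F (pos j) t * β (val j) t with hu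
  have huc : ∀ j, ContinuousOn (u j) (Metric.sphere 0 R₂) := fun j =>
    ((hFc _).div (hFc _) (hF2 _ (hpos1 j))).mul (hβc _)
  have huw : ∀ j t, F (pos k) t * w j t = u j t := fun j t => by
    simp only [hu, hw]
    ring
  have hmono : ∀ i j, i ≤ j → pos i ≤ pos j := fun i j hij => by
    rcases hij.eq_or_lt with rfl | h
    · exact le_rfl
    · have := hsep i j h
      omega
  -- slots after the `k`-th
  set L : ℂ → ℂ := fun t => ∑' j, u (j + (k + 1)) t with hL
  have hLb : ∀ j, ∀ t ∈ Metric.sphere (0 : ℂ) R₂,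
      ‖u (j + (k + 1)) t‖ ≤ C * q ^ val k * q ^ j := by
    intro j t ht
    have hq := pow_mul_le_pow hq0.le hq1.le (norm_nonneg (β (val (j + (k + 1))) t))
      (a := val (j + (k + 1))) (d := val k + j) (m := pos (j + (k + 1)) - pos k)
      (by have := hsep k (j + (k + 1)) (by omega); omega) (hβ2 _ t (hmem t ht))
    rw [hu, norm_mul]
    calc _ ≤ C * q ^ (pos (j + (k + 1)) - pos k) * ‖β (val (j + (k + 1))) t‖ := by
          gcongr
          exact h2 _ _ (hpos1 k) (hmono _ _ (by omega)) t (hmem t ht)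
      _ = C * (q ^ (pos (j + (k + 1)) - pos k) * ‖β (val (j + (k + 1))) t‖) := by ring
      _ ≤ C * q ^ (val k + j) := by gcongr
      _ = C * q ^ val k * q ^ j := by ring
  have hLc : ContinuousOn L (Metric.sphere 0 R₂) :=
    continuousOn_tsum (fun j => huc _) (hgeo.mul_left (C * q ^ val k)) hLb
  have hLn : ∀ t, ‖t‖ = R₂ → ‖L t‖ ≤ C * q ^ val k * (1 - q)⁻¹ := fun t ht =>
    tsum_of_norm_bounded ((hasSum_geometric_of_lt_one hq0.le hq1).mul_left _)
      fun j => hLb j t (by simpa using ht)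
  -- slots before the `k`-th
  set S : ℂ → ℂ := fun t => ∑ j ∈ Finset.range k, u j t with hS
  have hSd : ∀ t, min R₁ R₂ ≤ ‖t‖ → ‖t‖ ≤ max R₁ R₂ → DifferentiableAt ℂ S t := fun t ht ht' =>
    DifferentiableAt.fun_sum fun j _ =>
      ((hF _ t).div (hF _ t) (hF0 _ (hpos1 j) t ht ht')).mul (hβ _ t (hne t ht))
  have hSc : ContinuousOn S (Metric.sphere 0 R₂) := continuousOn_finsetSum _ fun j _ => huc j
  have hSn : ∀ t, ‖t‖ = R₁ → ‖S t‖ ≤ C * q ^ val k * (1 - q)⁻¹ := by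
    intro t ht
    have hterm : ∀ j ∈ Finset.range k, ‖u j t‖ ≤ C * q ^ val k * q ^ (k - 1 - j) := by
      intro j hj
      have hjk := Finset.mem_range.1 hj
      have hq := pow_mul_le_pow hq0.le hq1.le (norm_nonneg (β (val j) t))
        (a := val j) (d := val k + (k - 1 - j)) (m := pos k - pos j)
        (by have := hsep j k hjk; omega) (hβ1 _ t ht)
      rw [hu, norm_mul]
      calc _ ≤ C * q ^ (pos k - pos j) * ‖β (val j) t‖ := by
            gcongr
            exact h1 _ _ (hpos1 j) (hmono _ _ hjk.le) t ht
        _ = C * (q ^ (pos k - pos j) * ‖β (val j) t‖) := by ring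
        _ ≤ C * q ^ (val k + (k - 1 - j)) := by gcongr
        _ = C * q ^ val k * q ^ (k - 1 - j) := by ring
    refine (norm_sum_le_of_le _ hterm).trans ?_
    rw [← Finset.mul_sum, Finset.sum_range_reflect (fun i => q ^ i) k,
      ← tsum_geometric_of_lt_one hq0.le hq1]
    gcongr
    exact hgeo.sum_le_tsum _ fun i _ => by positivity
  have hsplit : ∀ t, ‖t‖ = R₂ → F (pos k) t * G t = S t + (β (val k) t + L t) := by
    intro t ht
    have ht' : t ∈ Metric.sphere (0 : ℂ) R₂ := by simpa using ht
    have hsw : Summable fun j => w j t :=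
      Summable.of_norm_bounded (hgeo.mul_left (C * μ)) fun j => hwb j t ht'
    have hsu : Summable fun j => u j t := by
      simpa only [huw] using hsw.mul_left (F (pos k) t)
    have huk : u k t = β (val k) t := by
      simp only [hu]
      rw [div_self (hF2 _ (hpos1 k) t ht'), one_mul]
    simp only [hG, hS, hL]
    rw [← tsum_mul_left]
    simp only [huw]
    rw [← hsu.sum_add_tsum_nat_add (k + 1), Finset.sum_range_succ, huk, add_assoc]
  rw [borelLaplace_congr hR₂.le hsplit, borelLaplace_add hR₂.le hSc ((hβc _).fun_add hLc),
    borelLaplace_add hR₂.le (hβc _) hLc, ← borelLaplace_eq_of_differentiableAt hR₁ hR₂ hSd]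
  have hb1 := norm_borelLaplace_le hR₁.le hSn z
  have hb2 := norm_borelLaplace_le hR₂.le hLn z
  have hq' : 0 < 1 - q := by linarith
  calc _ = ‖borelLaplace R₁ S z + borelLaplace R₂ L z‖ := by
        congr 1
        ring
    _ ≤ R₁ * (C * q ^ val k * (1 - q)⁻¹) * Real.exp (R₁ * ‖z‖) +
        R₂ * (C * q ^ val k * (1 - q)⁻¹) * Real.exp (R₂ * ‖z‖) :=
        (norm_add_le _ _).trans (add_le_add hb1 hb2)
    _ ≤ R₁ * (C * q ^ val k * (1 - q)⁻¹) * Real.exp (max R₁ R₂ * ‖z‖) +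
        R₂ * (C * q ^ val k * (1 - q)⁻¹) * Real.exp (max R₁ R₂ * ‖z‖) := by
        gcongr
        · exact le_max_left _ _
        · exact le_max_right _ _
    _ = _ := by ring

/-! ### Frequent hypercyclicity -/

/-- A sequence of operators multiplying densities by functions `F n` whose quotients decay
geometrically on two circles is frequently hypercyclic. -/
theorem isFrequentlyHypercyclic_of_multiplier {T : ℕ → EntireFunctions →L[ℂ] EntireFunctions}
    {F : ℕ → ℂ → ℂ} {R₁ R₂ : ℝ} (hR₁ : 0 < R₁) (hR₂ : 0 < R₂)
    (hF : ∀ n, Differentiable ℂ (F n))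
    (hF0 : ∀ n, 1 ≤ n → ∀ t, min R₁ R₂ ≤ ‖t‖ → ‖t‖ ≤ max R₁ R₂ → F n t ≠ 0)
    (hT : ∀ (n : ℕ) (G : ℂ → ℂ) (f : EntireFunctions), ContinuousOn G (Metric.sphere 0 R₂) →
      (∀ z, f.1 z = borelLaplace R₂ G z) →
      ∀ z, (T n f).1 z = borelLaplace R₂ (fun t => F n t * G t) z)
    {C q : ℝ} (hC : 0 < C) (hq0 : 0 < q) (hq1 : q < 1)
    (h1 : ∀ n k, 1 ≤ n → n ≤ k → ∀ t, ‖t‖ = R₁ → ‖F k t / F n t‖ ≤ C * q ^ (k - n))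
    (h2 : ∀ k n, 1 ≤ k → k ≤ n → ∀ t, ‖t‖ = R₂ → ‖F k t / F n t‖ ≤ C * q ^ (n - k)) :
    IsFrequentlyHypercyclic T := by
  obtain ⟨pos, val, hpos, hsep, hval⟩ := exists_separated_slots
  have hmono : StrictMono pos := strictMono_nat_of_lt_succ fun i => by
    have := hsep i (i + 1) (Nat.lt_succ_self i)
    omega
  have : SecondCountableTopology EntireFunctions :=
    TopologicalSpace.Subtype.secondCountableTopology (entireSubmodule : Set C(ℂ, ℂ))
  -- a countable base of nonempty open sets, each with a target in it
  obtain ⟨ℬ, hℬc, hℬ0, hℬ⟩ := TopologicalSpace.exists_countable_basis EntireFunctions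
  obtain ⟨V, hV, -, -⟩ := hℬ.exists_subset_of_mem_open (Set.mem_univ (0 : EntireFunctions))
    isOpen_univ
  obtain ⟨U, rfl⟩ := hℬc.exists_eq_range ⟨V, hV⟩
  have hUo : ∀ m, IsOpen (U m) := fun m => hℬ.isOpen (Set.mem_range_self m)
  have hUne : ∀ m, (U m).Nonempty := fun m =>
    Set.nonempty_iff_ne_empty.2 fun h => hℬ0 ⟨m, h⟩
  choose b hb p hp hpb using fun m => exists_borelLaplace_mem (hUo m) (hUne m) hR₂
  choose η hη hηU using fun m =>
    exists_exponential_neighborhood (hUo m) (hp m) (hR₁.le.trans (le_max_left R₁ R₂))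
  have hbound : ∀ m, ∃ M, ∀ t, ‖t‖ = R₁ ∨ ‖t‖ = R₂ → ‖b m t‖ ≤ M := by
    intro m
    have hK : IsCompact (Metric.sphere (0 : ℂ) R₁ ∪ Metric.sphere 0 R₂) :=
      (isCompact_sphere _ _).union (isCompact_sphere _ _)
    obtain ⟨M, hM⟩ := hK.exists_bound_of_continuousOn (f := b m) fun t ht => by
      have ht0 : t ≠ 0 := by
        rcases ht with ht | ht
        · exact Metric.ne_of_mem_sphere ht hR₁.ne'
        · exact Metric.ne_of_mem_sphere ht hR₂.ne'
      exact (hb m t ht0).continuousAt.continuousWithinAt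
    exact ⟨M, fun t ht => hM t (by simpa using ht)⟩
  choose M hM using hbound
  -- the `m`-th target is admitted at a label `v` only if `v` is large enough for it
  set A : ℝ := (R₁ + R₂) * (C * (1 - q)⁻¹) with hA
  set P : ℕ → ℕ → Prop := fun m v => M m * q ^ v ≤ 1 ∧ A * q ^ v ≤ η m with hP
  have hPev : ∀ m, ∀ᶠ v in atTop, P m v := by
    intro m
    have hlim : ∀ a : ℝ, Tendsto (fun v : ℕ => a * q ^ v) atTop (𝓝 0) := fun a => by
      simpa using (tendsto_pow_atTop_nhds_zero_of_lt_one hq0.le hq1).const_mul a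
    exact ((hlim (M m)).eventually (ge_mem_nhds one_pos)).and
      ((hlim A).eventually (ge_mem_nhds (hη m)))
  classical
  set β : ℕ → ℂ → ℂ := fun v => if P v.unpair.1 v then b v.unpair.1 else 0 with hβ
  have hβb : ∀ v t, ‖t‖ = R₁ ∨ ‖t‖ = R₂ → ‖β v t‖ * q ^ v ≤ 1 := by
    intro v t ht
    simp only [hβ]
    split_ifs with h
    · exact (mul_le_mul_of_nonneg_right (hM _ t ht) (by positivity)).trans h.1
    · simp
  have hβd : ∀ v t, t ≠ 0 → DifferentiableAt ℂ (β v) t := by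
    intro v t ht
    simp only [hβ]
    split_ifs with h
    · exact hb _ t ht
    · exact differentiableAt_const 0
  obtain ⟨f, hf⟩ := exists_orbit_near_targets hR₁ hR₂ hF hF0 hT hC hq0 hq1 h1 h2 hpos hsep hβd
    (fun v t ht => hβb v t (Or.inl ht)) (fun v t ht => hβb v t (Or.inr ht))
  refine ⟨f, fun W hW ⟨x, hx⟩ => ?_⟩
  obtain ⟨_, ⟨m, rfl⟩, -, hmW⟩ := hℬ.exists_subset_of_mem_open hx hW
  obtain ⟨N, hN⟩ := eventually_atTop.1 (hPev m)
  -- labels coding `m` in their first component are arbitrarily large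
  have hPm : P m (Nat.pair m N) := hN _ (Nat.right_le_pair m N)
  obtain ⟨g, hg, hgv, K, hK⟩ := hval (Nat.pair m N)
  refine lowerDensity_pos_of_linear_growth (hmono.injective.comp hg) (fun i => ⟨?_, hmW ?_⟩)
    (fun i => ?_) hK
  · exact le_trans (by omega) (hpos (g i))
  · refine hηU m _ fun z => ?_
    have h := hf (g i) z
    have hβm : β (Nat.pair m N) = b m := by
      simp only [hβ, Nat.unpair_pair, if_pos hPm]
    rw [hgv, hβm, ← hpb m z] at h
    exact h.trans (mul_le_mul_of_nonneg_right hPm.2 (Real.exp_nonneg _))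
  · exact le_trans (by omega) (hpos (g i))

theorem pow_div_pow_eq_pow_sub {x : ℂ} (hx : x ≠ 0) {m n : ℕ} (h : n ≤ m) :
    x ^ m / x ^ n = x ^ (m - n) := by
  rw [div_eq_iff (pow_ne_zero _ hx), ← pow_add, Nat.sub_add_cancel h]

theorem exists_norm_le_lt_of_sphere {Φ : ℂ → ℂ} (hΦ : Continuous Φ) {R a : ℝ} (hR : 0 ≤ R)
    (h : ∀ t : ℂ, ‖t‖ = R → ‖Φ t‖ < a) : ∃ M < a, ∀ t : ℂ, ‖t‖ = R → ‖Φ t‖ ≤ M := by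
  obtain ⟨t₀, ht₀, hmax⟩ := (isCompact_sphere (0 : ℂ) R).exists_isMaxOn
    (NormedSpace.sphere_nonempty.2 hR) hΦ.norm.continuousOn
  exact ⟨‖Φ t₀‖, h t₀ (by simpa using ht₀), fun t ht => hmax (by simpa using ht)⟩

theorem exists_lt_le_norm_of_sphere {Φ : ℂ → ℂ} (hΦ : Continuous Φ) {R a : ℝ} (hR : 0 ≤ R)
    (h : ∀ t : ℂ, ‖t‖ = R → a < ‖Φ t‖) : ∃ M > a, ∀ t : ℂ, ‖t‖ = R → M ≤ ‖Φ t‖ := by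
  obtain ⟨t₀, ht₀, hmin⟩ := (isCompact_sphere (0 : ℂ) R).exists_isMinOn
    (NormedSpace.sphere_nonempty.2 hR) hΦ.norm.continuousOn
  exact ⟨‖Φ t₀‖, h t₀ (by simpa using ht₀), fun t ht => hmin (by simpa using ht)⟩

theorem isFrequentlyHypercyclic_smul_diffOp_pow {c : ℕ → ℂ} (hc : ∀ n : ℕ, 1 ≤ n → c n ≠ 0)
    {γ δ : ℝ} (hγ_pos : 0 < γ) (hδ_pos : 0 < δ)
    (hγ : ∀ γ' < γ, ∀ᶠ n in atTop, γ' < ‖c (n + 1) / c n‖)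
    (hδ : ∀ δ' > δ, ∀ᶠ n in atTop, ‖c (n + 1) / c n‖ < δ')
    {Φ : ℂ → ℂ} (hΦ : IsExponentialType Φ) {R₁ R₂ : ℝ} (hR₁ : 0 < R₁) (hR₂ : 0 < R₂)
    (h1 : ∀ t : ℂ, ‖t‖ = R₁ → ‖Φ t‖ < 1 / δ) (h2 : ∀ t : ℂ, ‖t‖ = R₂ → 1 / γ < ‖Φ t‖)
    (h0 : ∀ t : ℂ, min R₁ R₂ ≤ ‖t‖ → ‖t‖ ≤ max R₁ R₂ → Φ t ≠ 0) :
    IsFrequentlyHypercyclic (fun n : ℕ => c n • diffOp Φ hΦ ^ n) := by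
  obtain ⟨M₀, hM₀, hΦM₀⟩ := exists_norm_le_lt_of_sphere hΦ.1.continuous hR₁.le h1
  obtain ⟨μ, hμ, hΦμ⟩ := exists_lt_le_norm_of_sphere hΦ.1.continuous hR₂.le h2
  have hμ0 : 0 < μ := lt_trans (by positivity) hμ
  -- a positive bound for `Φ` on the first circle leaves room for a ratio `δ'` above `δ`
  obtain ⟨M, hM, hMδ⟩ := exists_between (max_lt hM₀ (by positivity : 0 < 1 / δ))
  have hM0 : 0 < M := (le_max_right _ _).trans_lt hM
  have hΦM : ∀ t : ℂ, ‖t‖ = R₁ → ‖Φ t‖ ≤ M := fun t ht =>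
    (hΦM₀ t ht).trans ((le_max_left _ _).trans hM.le)
  obtain ⟨δ', hδδ', hδ'⟩ := exists_between ((lt_one_div hM0 hδ_pos).1 hMδ)
  obtain ⟨γ', hγ'μ, hγ'γ⟩ := exists_between ((one_div_lt hγ_pos hμ0).1 hμ)
  have hδ'0 : 0 < δ' := hδ_pos.trans hδδ'
  have hγ'0 : 0 < γ' := lt_trans (by positivity) hγ'μ
  have hcpos : ∀ n, 1 ≤ n → 0 < ‖c n‖ := fun n hn => norm_pos_iff.2 (hc n hn)
  obtain ⟨C₁, hC₁, hr₁⟩ := exists_const_le_mul_pow (a := fun n => ‖c n‖) hcpos hδ'0 (by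
    filter_upwards [hδ δ' hδδ', eventually_ge_atTop 1] with n hn hn1
    rw [norm_div, div_lt_iff₀ (hcpos n hn1)] at hn
    exact hn.le)
  obtain ⟨C₂, hC₂, hr₂⟩ := exists_const_le_mul_pow (a := fun n => ‖c n‖⁻¹)
    (fun n hn => inv_pos.2 (hcpos n hn)) (inv_pos.2 hγ'0) (by
    filter_upwards [hγ γ' hγ'γ, eventually_ge_atTop 1] with n hn hn1
    have hp := hcpos n hn1
    rw [norm_div, lt_div_iff₀ hp] at hn
    rw [← mul_inv]
    exact inv_anti₀ (by positivity) hn.le)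
  have hq₁ : δ' * M < 1 := (lt_div_iff₀ hM0).1 hδ'
  have hq₂ : (γ' * μ)⁻¹ < 1 := inv_lt_one_of_one_lt₀ ((div_lt_iff₀ hμ0).1 hγ'μ)
  refine isFrequentlyHypercyclic_of_multiplier (F := fun n t => c n * Φ t ^ n) hR₁ hR₂
    (fun n => (hΦ.1.pow n).const_mul _)
    (fun n hn t ht ht' => mul_ne_zero (hc n hn) (pow_ne_zero _ (h0 t ht ht')))
    (fun n G f hG hf z => ?_) (C := max C₁ C₂) (q := max (δ' * M) (γ' * μ)⁻¹)
    (lt_max_of_lt_left hC₁) (lt_max_of_lt_left (by positivity)) (max_lt hq₁ hq₂)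
    (fun n k hn hnk t ht => ?_) (fun k n hk hkn t ht => ?_)
  · change c n * ((diffOp Φ hΦ ^ n) f).1 z = _
    rw [diffOp_pow_borelLaplace hΦ hR₂ hG hf]
    simp only [mul_assoc, borelLaplace_const_mul]
  · have ht0 : Φ t ≠ 0 := h0 t (ht ▸ min_le_left _ _) (ht ▸ le_max_left _ _)
    have hcn := hcpos n hn
    have e : ‖c k * Φ t ^ k / (c n * Φ t ^ n)‖ = ‖c k‖ / ‖c n‖ * ‖Φ t‖ ^ (k - n) := by
      rw [mul_div_mul_comm, norm_mul, norm_div, pow_div_pow_eq_pow_sub ht0 hnk, norm_pow]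
    rw [e]
    calc ‖c k‖ / ‖c n‖ * ‖Φ t‖ ^ (k - n) ≤ C₁ * δ' ^ (k - n) * M ^ (k - n) := by
          gcongr
          · exact (div_le_iff₀ hcn).2 (hr₁ n k hn hnk)
          · exact hΦM t ht
      _ = C₁ * (δ' * M) ^ (k - n) := by rw [mul_pow, mul_assoc]
      _ ≤ _ := by
          gcongr
          · exact le_max_left _ _
          · exact le_max_left _ _
  · have ht0 : Φ t ≠ 0 := h0 t (ht ▸ min_le_right _ _) (ht ▸ le_max_right _ _)
    have hck := hcpos k hk
    have hcn := hcpos n (hk.trans hkn)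
    have e : ‖c k * Φ t ^ k / (c n * Φ t ^ n)‖ = ‖c n‖⁻¹ / ‖c k‖⁻¹ * (‖Φ t‖⁻¹) ^ (n - k) := by
      rw [mul_div_mul_comm, norm_mul, norm_div, ← inv_div (Φ t ^ n), pow_div_pow_eq_pow_sub ht0 hkn,
        norm_inv, norm_pow, inv_pow, div_inv_eq_mul, div_eq_mul_inv, mul_comm ‖c k‖]
    rw [e]
    calc ‖c n‖⁻¹ / ‖c k‖⁻¹ * (‖Φ t‖⁻¹) ^ (n - k) ≤ C₂ * γ'⁻¹ ^ (n - k) * μ⁻¹ ^ (n - k) := by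
          gcongr
          · exact (div_le_iff₀ (inv_pos.2 hck)).2 (hr₂ k n hk hkn)
          · exact hΦμ t ht
      _ = C₂ * ((γ' * μ)⁻¹) ^ (n - k) := by rw [mul_inv, mul_pow, mul_assoc]
      _ ≤ _ := by
          gcongr
          · exact le_max_right _ _
          · exact le_max_right _ _

theorem mainTheorem2 (c : ℕ → ℂ) (hc : ∀ n : ℕ, 1 ≤ n → c n ≠ 0)
    (γ δ : ℝ)
    (hγ : (γ : EReal) = liminf (fun n : ℕ => ((‖c (n + 1) / c n‖ : ℝ) : EReal)) atTop)
    (hδ : (δ : EReal) = limsup (fun n : ℕ => ((‖c (n + 1) / c n‖ : ℝ) : EReal)) atTop)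
    (hγ_pos : 0 < γ) :
    (∀ (Φ : ℂ → ℂ) (hΦ : IsExponentialType Φ) (R₁ R₂ : ℝ), 0 < R₁ → 0 < R₂ →
      (∀ t : ℂ, ‖t‖ = R₁ → ‖Φ t‖ < 1 / δ) →
      (∀ t : ℂ, ‖t‖ = R₂ → 1 / γ < ‖Φ t‖) →
      (∀ t : ℂ, min R₁ R₂ ≤ ‖t‖ → ‖t‖ ≤ max R₁ R₂ → Φ t ≠ 0) →
      IsFrequentlyHypercyclic (fun n : ℕ => c n • diffOp Φ hΦ ^ n)) ∧
    IsFrequentlyHypercyclic (fun n : ℕ => c n • derivOp ^ n) := by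
  have hγδ : γ ≤ δ := by
    have : (γ : EReal) ≤ δ := by
      rw [hγ, hδ]
      exact liminf_le_limsup
    exact_mod_cast this
  have hδ_pos : 0 < δ := hγ_pos.trans_le hγδ
  have hγ' : ∀ γ' < γ, ∀ᶠ n in atTop, γ' < ‖c (n + 1) / c n‖ := fun γ' h => by
    have h' : (γ' : EReal) < liminf (fun n : ℕ => ((‖c (n + 1) / c n‖ : ℝ) : EReal)) atTop :=
      hγ ▸ EReal.coe_lt_coe_iff.2 h
    exact (eventually_lt_of_lt_liminf h').mono fun n hn => EReal.coe_lt_coe_iff.1 hn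
  have hδ' : ∀ δ' > δ, ∀ᶠ n in atTop, ‖c (n + 1) / c n‖ < δ' := fun δ' h => by
    have h' : limsup (fun n : ℕ => ((‖c (n + 1) / c n‖ : ℝ) : EReal)) atTop < (δ' : EReal) :=
      hδ ▸ EReal.coe_lt_coe_iff.2 h
    exact (eventually_lt_of_limsup_lt h').mono fun n hn => EReal.coe_lt_coe_iff.1 hn
  refine ⟨fun Φ hΦ R₁ R₂ hR₁ hR₂ h1 h2 h0 =>
    isFrequentlyHypercyclic_smul_diffOp_pow hc hγ_pos hδ_pos hγ' hδ' hΦ hR₁ hR₂ h1 h2 h0, ?_⟩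
  -- `D` is `Φ(D)` for `Φ t = t`, and any `R₁ < 1 / δ` and `R₂ > 1 / γ` will do
  have hr₁ : 0 < 1 / (2 * δ) := by positivity
  have hr₂ : 0 < 2 / γ := by positivity
  rw [← diffOp_id]
  refine isFrequentlyHypercyclic_smul_diffOp_pow hc hγ_pos hδ_pos hγ' hδ' _ hr₁ hr₂
    (fun t ht => ?_) (fun t ht => ?_) (fun t ht _ => ?_)
  · rw [ht]
    exact one_div_lt_one_div_of_lt hδ_pos (by linarith)
  · rw [ht]
    gcongr
    norm_num
  · exact norm_pos_iff.1 ((lt_min hr₁ hr₂).trans_le ht)
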